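/- All groups are finite. For a finite group $G$, let $\mathrm{Irr}(G)$ be the set of complex irreducible characters of $G$. For $\chi\in\mathrm{Irr}(G)$ let $\ker\chi=\{g\in G:\chi(g)=\chi(1)\}$, let $\mathrm{cod}(\chi)=|G:\ker\chi|/\chi(1)$ be its codegree, and put $S_c(G)=\sum_{\chi\in\mathrm{Irr}(G)}\mathrm{cod}(\chi)$. Let $C_n$ denote the cyclic group of order $n$, and let $p_1<p_2<\cdots$ be the primes congruent to $2$ modulo $3$ in increasing order. For an integer $t\ge 0$, let $\mathcal G_t$ be the class of finite groups $G=A\rtimes P$ that are semidirect products of a normal subgroup $A\cong C_{p_1}^2\times\cdots\times C_{p_t}^2$ and a subgroup $P\cong C_3$ with $C_A(P)=1$. **Theorem.** 1. For every $t$ the class $\mathcal G_t$ is non-empty. 2. $S_c(G)/S_c(C_{|G|})\to\infty$ as $t\to\infty$ for $G\in\mathcal G_t$; that is, for every real $M$ there is a $T$ such that for all $t\ge T$ and all $G\in\mathcal G_t$ one has $S_c(G)/S_c(C_{|G|})\ge M$. 3. Consequently, there are an integer $n\ge 1$ and a finite group $G$ of order $n$ with $S_c(G)>S_c(C_n)$;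 so the question whether $S_c(G)\le S_c(C_n)$ holds for every finite group $G$ of order $n$ has a negative answer. -/

import Mathlib

namespace CodegreeSum

/-- `Irr G`: the set of characters of the irreducible complex representations of `G`
of finite dimension (every such representation can be realised on some `ℂ ^ d`). -/
def Irr (G : Type*) [Group G] : Set (G → ℂ) :=
  {χ | ∃ (d : ℕ) (ρ : Representation ℂ G (Fin d → ℂ)), ρ.IsIrreducible ∧ ρ.character = χ}

/-- A finite group has only finitely many irreducible characters. -/
theorem irr_finite (G : Type*) [Group G] [Finite G] : (Irr G).Finite := by
  classical
  have := Fintype.ofFinite G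
  have hc : (Nat.card G : ℂ) ≠ 0 := by exact_mod_cast Nat.card_pos.ne'
  let _ : Invertible (Nat.card G : ℂ) := invertibleOfNonzero hc
  let B : LinearMap.BilinForm ℂ (G → ℂ) := LinearMap.mk₂ ℂ
    (fun f h => (Nat.card G : ℂ)⁻¹ * ∑ g : G, f g * h g⁻¹)
    (by intro a b c; simp [add_mul, Finset.sum_add_distrib, mul_add])
    (by intro a b c; simp only [Pi.smul_apply, smul_eq_mul, mul_assoc, Finset.mul_sum]
        exact Finset.sum_congr rfl fun _ _ => by ring)
    (by intro a b c; simp [mul_add, Finset.sum_add_distrib])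
    (by intro a b c; simp only [Pi.smul_apply, smul_eq_mul, Finset.mul_sum]
        exact Finset.sum_congr rfl fun _ _ => by ring)
  have hli : LinearIndependent ℂ (fun χ : Irr G => (χ : G → ℂ)) := by
    refine LinearMap.BilinForm.linearIndependent_of_iIsOrtho (B := B) ?_ ?_
    · rintro ⟨χ, d, ρ, hρ, rfl⟩ ⟨ψ, e, σ, hσ, rfl⟩ hne
      have h := Representation.char_orthonormal ρ σ
      rw [if_neg] at h
      · exact h
      · rintro ⟨φ⟩
        exact hne (Subtype.ext (Representation.char_iso φ).symm)
    · rintro ⟨χ, d, ρ, hρ, rfl⟩ h0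
      have h := Representation.char_orthonormal ρ ρ
      rw [if_pos ⟨Representation.Equiv.refl ρ⟩] at h
      exact one_ne_zero (h.symm.trans h0)
  exact hli.setFinite

/-- The kernel `{g | χ(g) = χ(1)}` of a character `χ`. -/
def charKer {G : Type*} [Group G] (χ : G → ℂ) : Set G := {g | χ g = χ 1}

/-- The codegree `|G : ker χ| / χ(1)` of a character `χ` of a finite group. The degree `χ(1)` is
the dimension of a representation, so it equals its real part. -/
noncomputable def codegree {G : Type*} [Group G] (χ : G → ℂ) : ℝ :=
  ((Nat.card G : ℝ) / (Nat.card (charKer χ) : ℝ)) / (χ 1).re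

/-- `S_c(G)`: the sum of the codegrees of the irreducible characters of a finite group `G`.
The sum is finite by `irr_finite`. -/
noncomputable def Sc (G : Type*) [Group G] : ℝ := ∑ᶠ χ ∈ Irr G, codegree χ

/-- The cyclic group `C_n`, for `n ≥ 1`. -/
abbrev C (n : ℕ) : Type := Multiplicative (ZMod n)

/-- The primes congruent to `2` modulo `3` in increasing order, indexed from `0`. -/
noncomputable def prime23 (i : ℕ) : ℕ := Nat.nth (fun p => p.Prime ∧ p % 3 = 2) i

/-- `G = A ⋊ P` with `P ≅ C_3`, with `A ≅ C_{p₁}² × ⋯ × C_{pₜ}²` for the first `t` primes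
`p₁ < ⋯ < pₜ` congruent to `2` modulo `3`, and with `C_A(P) = 1`. -/
def IsExample (t : ℕ) (G : Type*) [Group G] : Prop :=
  ∃ A P : Subgroup G, A.Normal ∧ A.IsComplement' P ∧ Nonempty (P ≃* C 3) ∧
    Nonempty (A ≃* ((i : Fin t) → C (prime23 i) × C (prime23 i))) ∧
    A ⊓ Subgroup.centralizer (P : Set G) = ⊥

end CodegreeSum

/-! Write `N` for the kernel, of order `e ^ 2` with `e` the product of the chosen primes, and `H`
for the complement `C 3`. As `H` has prime order, no nontrivial element of it fixes a nontrivial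
element of `N`, so `G` is a Frobenius group when `N` is nontrivial. Hence each linear character `l ≠
1` of `N` induces an irreducible character of degree 3, and at most 3 choices of `l` give the same
one (`sum_le_card_mul_Sc`).

The kernel of the induced character lies in `coreKer φ l`, the largest `H`-invariant subgroup of
`ker l`. An invariant subgroup has order 1 modulo 3, so one of order `p ≡ 2` is impossible. Thus `H`
acts irreducibly on each `C_p²`, and the core has no `p`-part whenever `p` divides the order of `l`
(`coprime_card_coreKer_orderOf`). The codegree is therefore at least `(orderOf l) ^ 2`, and `3 * Sc
G` is at least `∏ (1 + (p² - 1) p²) - 1`.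

For the cyclic group, `Sc` is at most the sum of the element orders, `7 ∏ (1 + (p - 1) p + (p² - p)
p²)`. The two products differ at each prime by a factor of at least `1 + 1 / (4 p)`, and the sum of
`1 / p` over primes `p ≡ 2` modulo 3 diverges by Dirichlet's theorem in its analytic form. -/

/-! ### Divergence of the sum of reciprocals of primes in a residue class -/

section Primes

open ArithmeticFunction.vonMangoldt Filter Topology

/-- The sum of the reciprocals of the primes in an invertible residue class diverges. -/
theorem not_summable_indicator_prime_residueClass_one_div {q : ℕ} [NeZero q] {a : ZMod q}
    (ha : IsUnit a) :
    ¬ Summable ({p : ℕ | p.Prime ∧ (p : ZMod q) = a}.indicator fun n : ℕ => (1 : ℝ) / n) := by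
  intro hs
  set g := {p : ℕ | p.Prime ∧ (p : ZMod q) = a}.indicator fun n : ℕ => (1 : ℝ) / n with hg
  obtain ⟨C, hC⟩ := LSeries_residueClass_lower_bound ha
  have hsum := hs.add (summable_residueClass_non_primes_div a)
  have hmem : Set.Ioc (1 : ℝ) 2 ∈ 𝓝[>] (1 : ℝ) := Ioc_mem_nhdsGT (by norm_num)
  -- If the reciprocals were summable, dominated convergence would make `(x - 1)` times the
  -- Dirichlet series tend to 0 as `x → 1⁺`, whereas the pole at 1 keeps it near `1 / φ(q)`. The
  -- dominating series is `1 / n` on primes of the class plus the summable contribution of the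
  -- non-primes.
  have hlim : Tendsto (fun x : ℝ => ∑' n : ℕ, (x - 1) * (residueClass a n / (n : ℝ) ^ x))
      (𝓝[>] 1) (𝓝 (∑' _ : ℕ, (0 : ℝ))) := by
    refine tendsto_tsum_of_dominated_convergence hsum (fun n => ?_) ?_
    · rcases n.eq_zero_or_pos with rfl | hn
      · simp
      · have hn' : (n : ℝ) ≠ 0 := by positivity
        have hc : ContinuousAt (fun x : ℝ => (x - 1) * (residueClass a n / (n : ℝ) ^ x)) 1 := by
          refine ContinuousAt.mul (by fun_prop) (ContinuousAt.div (by fun_prop) ?_ (by positivity))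
          exact Real.continuousAt_const_rpow hn'
        have := hc.tendsto
        simp only [sub_self, zero_mul] at this
        exact this.mono_left nhdsWithin_le_nhds
    · filter_upwards [hmem] with x hx n
      obtain ⟨hx1, hx2⟩ := hx
      rcases n.eq_zero_or_pos with rfl | hn
      · simpa [hg] using Set.indicator_nonneg (fun _ _ => by positivity) 0
      have hn' : (1 : ℝ) ≤ n := by exact_mod_cast hn
      have hR := residueClass_nonneg a n
      have hnn : 0 ≤ (x - 1) * (residueClass a n / (n : ℝ) ^ x) :=
        mul_nonneg (by linarith) (by positivity)
      rw [Real.norm_of_nonneg hnn]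
      by_cases hp : n.Prime
      · simp only [hp, if_true, zero_div, add_zero]
        by_cases hna : (n : ZMod q) = a
        · have h1 : residueClass a n = Real.log n := by
            exact (Set.indicator_of_mem (s := {n : ℕ | (n : ZMod q) = a}) hna _).trans
              (ArithmeticFunction.vonMangoldt_apply_prime hp)
          have h2 : g n = 1 / n := Set.indicator_of_mem (by exact ⟨hp, hna⟩) _
          rw [h1, h2]
          -- The bound `log y ≤ y` at `y = n ^ (x - 1)` trades the logarithm for the excess in the
          -- exponent, uniformly in `x`.
          have h3 : (x - 1) * Real.log n ≤ (n : ℝ) ^ (x - 1) := by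
            rw [← Real.log_rpow (by positivity)]
            exact (Real.log_le_sub_one_of_pos (by positivity)).trans (by linarith)
          have h4 : (n : ℝ) ^ x = n ^ (x - 1) * n := by
            rw [← Real.rpow_add_one (by positivity)]; simp
          rw [← mul_div_assoc, h4, div_le_div_iff₀ (by positivity) (by positivity)]
          nlinarith
        · have h1 : residueClass a n = 0 := Set.indicator_of_notMem (by exact hna) _
          rw [h1]
          simp only [zero_div, mul_zero]
          exact Set.indicator_nonneg (fun _ _ => by positivity) _
      · have h2 : g n = 0 := Set.indicator_of_notMem (fun h => hp h.1) _
        rw [h2]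
        simp only [hp, if_false, zero_add]
        calc (x - 1) * (residueClass a n / (n : ℝ) ^ x)
            ≤ 1 * (residueClass a n / (n : ℝ) ^ x) := by
              apply mul_le_mul_of_nonneg_right (by linarith) (by positivity)
          _ ≤ residueClass a n / n := by
              rw [one_mul]
              refine div_le_div_of_nonneg_left hR (by positivity) ?_
              conv_lhs => rw [← Real.rpow_one (n : ℝ)]
              exact Real.rpow_le_rpow_of_exponent_le hn' hx1.le
  rw [tsum_zero] at hlim
  have hlow : Tendsto (fun x : ℝ => (q.totient : ℝ)⁻¹ - C * (x - 1)) (𝓝[>] 1)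
      (𝓝 (q.totient : ℝ)⁻¹) := by
    have : ContinuousAt (fun x : ℝ => (q.totient : ℝ)⁻¹ - C * (x - 1)) 1 := by fun_prop
    have := this.tendsto
    simp only [sub_self, mul_zero, sub_zero] at this
    exact this.mono_left nhdsWithin_le_nhds
  have hq : 0 < (q.totient : ℝ)⁻¹ := inv_pos.mpr (mod_cast q.totient.pos_of_neZero)
  refine absurd (le_of_tendsto_of_tendsto hlow hlim ?_) (not_le.mpr hq)
  filter_upwards [hmem] with x hx
  have h := mul_le_mul_of_nonneg_left (hC hx) (sub_pos.mpr hx.1).le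
  rw [tsum_mul_left]
  refine le_trans (le_of_eq ?_) h
  have : x - 1 ≠ 0 := (sub_pos.mpr hx.1).ne'
  field_simp

namespace CodegreeSum

theorem infinite_setOf_prime_mod_three_eq_two : {p : ℕ | p.Prime ∧ p % 3 = 2}.Infinite := by
  refine (Nat.infinite_setOfPred_prime_and_modEq (q := 3) (a := 2) (by norm_num)
    (by norm_num)).mono fun p hp => ?_
  exact ⟨hp.1, by have := hp.2; unfold Nat.ModEq at this; omega⟩

theorem prime_prime23 (i : ℕ) : (prime23 i).Prime :=
  (Nat.nth_mem_of_infinite infinite_setOf_prime_mod_three_eq_two i).1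

theorem prime23_mod_three (i : ℕ) : prime23 i % 3 = 2 :=
  (Nat.nth_mem_of_infinite infinite_setOf_prime_mod_three_eq_two i).2

theorem prime23_injective : Function.Injective prime23 :=
  (Nat.nth_strictMono infinite_setOf_prime_mod_three_eq_two).injective

theorem not_summable_one_div_prime23 : ¬ Summable fun i : ℕ => (1 : ℝ) / prime23 i := by
  intro h
  have hu : IsUnit (2 : ZMod 3) := by decide
  refine not_summable_indicator_prime_residueClass_one_div hu ?_
  rw [← Function.Injective.summable_iff prime23_injective]
  · refine h.congr fun i => ?_
    rw [Function.comp_apply, Set.indicator_of_mem]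
    refine ⟨prime_prime23 i, ?_⟩
    have := (ZMod.natCast_eq_natCast_iff (prime23 i) 2 3).mpr (prime23_mod_three i)
    exact_mod_cast this
  · intro n hn
    refine Set.indicator_of_notMem (fun hm => hn ?_) _
    have h2 := (ZMod.natCast_eq_natCast_iff n 2 3).mp (by exact_mod_cast hm.2)
    have : n ∈ Set.range (Nat.nth fun p => p.Prime ∧ p % 3 = 2) := by
      rw [Nat.range_nth_of_infinite infinite_setOf_prime_mod_three_eq_two]
      exact ⟨hm.1, h2⟩
    exact this

theorem tendsto_sum_one_div_prime23 :
    Tendsto (fun t : ℕ => ∑ i : Fin t, (1 : ℝ) / prime23 i) atTop atTop := by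
  have := (not_summable_iff_tendsto_nat_atTop_of_nonneg
    (fun i : ℕ => by positivity)).mp not_summable_one_div_prime23
  refine this.congr fun t => ?_
  rw [Finset.sum_range]

end CodegreeSum

end Primes

namespace CodegreeSum

/-! ### Irreducible characters and invariance of the codegree sum -/

section Characters

variable {G : Type*} [Group G]

/-- A representation on any finite-dimensional space contributes its character to `Irr G`. -/
theorem character_mem_Irr {V : Type*} [AddCommGroup V] [Module ℂ V] [FiniteDimensional ℂ V]
    (ρ : Representation ℂ G V) (hρ : ρ.IsIrreducible) : ρ.character ∈ Irr G := by
  let b := Module.finBasis ℂ V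
  let e : V ≃ₗ[ℂ] (Fin (Module.finrank ℂ V) → ℂ) := b.equivFun
  let σ : Representation ℂ G (Fin (Module.finrank ℂ V) → ℂ) :=
    { toFun := fun g => e.conj (ρ g)
      map_one' := by simp [Module.End.one_eq_id]
      map_mul' := fun g h => by simp [Module.End.mul_eq_comp, LinearEquiv.conj_comp] }
  refine ⟨_, σ, ?_, ?_⟩
  · let f : Subrepresentation ρ ≃o Subrepresentation σ :=
      { toFun := fun W => ⟨W.toSubmodule.map e.toLinearMap, by
          rintro g _ ⟨w, hw, rfl⟩
          refine ⟨ρ g w, W.apply_mem_toSubmodule g hw, ?_⟩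
          simp [σ, LinearEquiv.conj_apply]⟩
        invFun := fun W => ⟨W.toSubmodule.comap e.toLinearMap, by
          intro g w hw
          have := W.apply_mem_toSubmodule g hw
          simpa [σ, LinearEquiv.conj_apply] using this⟩
        left_inv := fun W => Subrepresentation.toSubmodule_injective
          (Submodule.comap_map_eq_of_injective e.injective _)
        right_inv := fun W => Subrepresentation.toSubmodule_injective
          (Submodule.map_comap_eq_of_surjective e.surjective _)
        map_rel_iff' := fun {W W'} => by
          exact Submodule.map_le_map_iff_of_injective (f := e.toLinearMap) e.injective
            W.toSubmodule W'.toSubmodule }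
    exact f.isSimpleOrder_iff.mp hρ
  · ext g
    exact LinearMap.trace_conj' (ρ g) e

theorem Irr_apply_one {χ : G → ℂ} (hχ : χ ∈ Irr G) : ∃ d : ℕ, χ 1 = d := by
  obtain ⟨d, ρ, -, rfl⟩ := hχ
  exact ⟨d, by simp [Representation.char_one]⟩

theorem codegree_nonneg {χ : G → ℂ} (hχ : χ ∈ Irr G) : 0 ≤ codegree χ := by
  obtain ⟨d, hd⟩ := Irr_apply_one hχ
  rw [codegree, hd, Complex.natCast_re]
  positivity

variable {H : Type*} [Group H]

theorem comp_mulEquiv_mem_Irr (e : G ≃* H) {χ : H → ℂ} (hχ : χ ∈ Irr H) : χ ∘ e ∈ Irr G := by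
  obtain ⟨d, ρ, hρ, rfl⟩ := hχ
  refine ⟨d, ρ.comp e.toMonoidHom, ?_, rfl⟩
  let f : Subrepresentation ρ ≃o Subrepresentation (ρ.comp e.toMonoidHom) :=
    { toFun := fun W => ⟨W.toSubmodule, fun g _ hw => W.apply_mem_toSubmodule (e g) hw⟩
      invFun := fun W => ⟨W.toSubmodule, fun g w hw => by
        have := W.apply_mem_toSubmodule (e.symm g) hw
        simpa using this⟩
      left_inv := fun W => rfl
      right_inv := fun W => rfl
      map_rel_iff' := Iff.rfl }
  exact f.isSimpleOrder_iff.mp hρ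

theorem codegree_comp_mulEquiv (e : G ≃* H) (χ : H → ℂ) : codegree (χ ∘ e) = codegree χ := by
  have h : Nat.card (charKer (χ ∘ e)) = Nat.card (charKer χ) :=
    Nat.card_congr (e.toEquiv.subtypeEquiv fun g => by simp [charKer])
  rw [codegree, codegree, h, Nat.card_congr e.toEquiv]
  simp

/-- `S_c` is an isomorphism invariant. -/
theorem Sc_congr (e : G ≃* H) : Sc G = Sc H := by
  refine (finsum_mem_eq_of_bijOn (fun χ : H → ℂ => χ ∘ e) ⟨fun χ hχ => ?_, ?_, ?_⟩ ?_).symm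
  · exact comp_mulEquiv_mem_Irr e hχ
  · exact e.surjective.injective_comp_right.injOn
  · intro χ hχ
    refine ⟨χ ∘ e.symm, comp_mulEquiv_mem_Irr e.symm hχ, ?_⟩
    ext g
    simp
  · exact fun χ _ => (codegree_comp_mulEquiv e χ).symm

end Characters

/-! ### Codegree sums of abelian and cyclic groups -/

section Abelian

/-- The irreducible characters of a finite abelian group are its homomorphisms to `ℂˣ`. -/
theorem Irr_eq_range_of_comm (G : Type*) [CommGroup G] :
    Irr G = Set.range fun (l : G →* ℂˣ) (g : G) => (l g : ℂ) := by
  ext χ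
  constructor
  · rintro ⟨d, ρ, hρ, rfl⟩
    have h1 := Representation.IsIrreducible.finrank_eq_one_of_isMulCommutative ρ
    have hs (g : G) : ∃ c : ℂ, ρ g = c • LinearMap.id := by
      obtain ⟨v, hv0, hv⟩ := finrank_eq_one_iff'.mp h1
      obtain ⟨c, hc⟩ := hv (ρ g v)
      refine ⟨c, LinearMap.ext fun w => ?_⟩
      obtain ⟨k, rfl⟩ := hv w
      simp [← hc]
    have hc (g : G) : ρ g = ρ.character g • LinearMap.id := by
      obtain ⟨c, hc⟩ := hs g
      have : ρ.character g = c := by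
        rw [Representation.character, hc, map_smul, LinearMap.trace_id, h1]
        simp
      rw [this, hc]
    have hone : ρ.character 1 = 1 := by rw [Representation.char_one, h1]; simp
    have hmul (g h : G) : ρ.character (g * h) = ρ.character g * ρ.character h := by
      conv_lhs => rw [Representation.character, map_mul, hc g, hc h]
      simp only [smul_mul_smul_comm, map_smul]
      rw [Module.End.mul_eq_comp, LinearMap.id_comp, LinearMap.trace_id, h1]
      simp
    let l : G →* ℂ := ⟨⟨ρ.character, hone⟩, hmul⟩
    exact ⟨l.toHomUnits, by ext g; simp [l]⟩
  · rintro ⟨l, rfl⟩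
    let ρ : Representation ℂ G ℂ :=
      (Algebra.lmul ℂ ℂ).toMonoidHom.comp ((Units.coeHom ℂ).comp l)
    have hρ : ρ.IsIrreducible := by
      have : Nontrivial (Subrepresentation ρ) := by
        refine ⟨⊥, ⊤, fun h => ?_⟩
        have := congrArg Subrepresentation.toSubmodule h
        exact bot_ne_top (α := Submodule ℂ ℂ) this
      refine ⟨fun W => ?_⟩
      rcases eq_bot_or_eq_top (α := Submodule ℂ ℂ) W.toSubmodule with h | h
      · exact Or.inl (Subrepresentation.toSubmodule_injective h)
      · exact Or.inr (Subrepresentation.toSubmodule_injective h)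
    convert! character_mem_Irr ρ hρ using 1
    ext g
    simp [ρ, Representation.character, LinearMap.trace_eq_matrix_trace ℂ (Module.Basis.singleton Unit ℂ),
      Matrix.trace, LinearMap.toMatrix_apply]

variable (G : Type*) [CommGroup G]

theorem Sc_eq_finsum_of_comm :
    Sc G = ∑ᶠ l : G →* ℂˣ, (Nat.card G : ℝ) / Nat.card l.ker := by
  have hinj : Function.Injective fun (l : G →* ℂˣ) (g : G) => (l g : ℂ) := fun l m h =>
    MonoidHom.ext fun g => Units.ext (congrFun h g)
  rw [Sc, Irr_eq_range_of_comm, finsum_mem_range hinj]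
  refine finsum_congr fun l => ?_
  have : charKer (fun g => (l g : ℂ)) = (l.ker : Set G) := by
    ext g
    simp [charKer, MonoidHom.mem_ker]
  rw [codegree, this]
  simp

theorem Sc_pos_of_comm [Finite G] : 0 < Sc G := by
  rw [Sc_eq_finsum_of_comm]
  have : Finite (G →* ℂˣ) := (CommGroup.monoidHom_mulEquiv_of_hasEnoughRootsOfUnity G ℂ).some.toEquiv.finite_iff.mpr ‹_›
  have := Fintype.ofFinite (G →* ℂˣ)
  rw [finsum_eq_sum_of_fintype]
  refine Finset.sum_pos (fun l _ => ?_) Finset.univ_nonempty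
  have := Nat.card_pos (α := G)
  have := Nat.card_pos (α := l.ker)
  positivity

/-- The codegree of `l` is the order of its image, generated by the value of `l` at a generator of
`G`, and so divides `orderOf l`. The dual group is isomorphic to `G`, which turns orders of
characters into orders of elements. -/
theorem Sc_le_sum_orderOf_of_isCyclic [Fintype G] [IsCyclic G] :
    Sc G ≤ ∑ g : G, (orderOf g : ℝ) := by
  rw [Sc_eq_finsum_of_comm]
  have e := (CommGroup.monoidHom_mulEquiv_of_hasEnoughRootsOfUnity G ℂ).some
  have : Finite (G →* ℂˣ) := e.toEquiv.finite_iff.mpr inferInstance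
  have := Fintype.ofFinite (G →* ℂˣ)
  rw [finsum_eq_sum_of_fintype, ← Equiv.sum_comp e.toEquiv]
  refine Finset.sum_le_sum fun l _ => ?_
  have h1 := l.ker.card_eq_card_quotient_mul_card_subgroup
  have hk := Nat.card_pos (α := l.ker)
  have h2 : (Nat.card G : ℝ) / Nat.card l.ker = Nat.card (G ⧸ l.ker) := by
    rw [h1, Nat.cast_mul]
    field_simp
  have h3 : orderOf (e.toEquiv l) = orderOf l := MulEquiv.orderOf_eq e l
  rw [h2, h3]
  obtain ⟨g, hg⟩ := IsCyclic.exists_generator (α := G)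
  have h4 : Nat.card (G ⧸ l.ker) = orderOf (l g) := by
    rw [Nat.card_congr (QuotientGroup.quotientKerEquivRange l).toEquiv, ← Nat.card_zpowers]
    congr 2
    ext y
    simp only [MonoidHom.mem_range, Subgroup.mem_zpowers_iff]
    constructor
    · rintro ⟨x, rfl⟩
      obtain ⟨k, rfl⟩ := Subgroup.mem_zpowers_iff.mp (hg x)
      exact ⟨k, by simp⟩
    · rintro ⟨k, rfl⟩
      exact ⟨g ^ k, by simp⟩
  rw [h4]
  have h5 : orderOf (l g) ∣ orderOf l := orderOf_dvd_of_pow_eq_one (by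
    rw [← MonoidHom.pow_apply, pow_orderOf_eq_one, MonoidHom.one_apply])
  have h6 : 0 < orderOf l := orderOf_pos l
  exact_mod_cast Nat.le_of_dvd h6 h5

end Abelian

end CodegreeSum

namespace CodegreeSum

theorem re_le_one_of_pow_eq_one (u : ℂˣ) (n : ℕ) (hn : n ≠ 0) (hu : u ^ n = 1) :
    (u : ℂ).re ≤ 1 ∧ ((u : ℂ).re = 1 → u = 1) := by
  have h1 : ‖(u : ℂ)‖ = 1 := Complex.norm_eq_one_of_pow_eq_one (by simpa using congrArg Units.val hu) hn
  refine ⟨h1 ▸ Complex.re_le_norm _, fun h => Units.ext ?_⟩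
  have := Complex.re_eq_norm.mp (h.trans h1.symm)
  apply Complex.ext
  · simpa using h
  · simpa using this.2.symm

/-! ### Characters induced from the abelian kernel of a Frobenius group -/

section Induced

open scoped Classical

variable {N H : Type*} [CommGroup N] [Group H] (φ : H →* MulAut N)

/-- The conjugate `a ↦ l (φ z a)` of a linear character of `N`. -/
def conjChar (l : N →* ℂˣ) (z : H) : N →* ℂˣ := l.comp (φ z).toMonoidHom

theorem conjChar_apply (l : N →* ℂˣ) (z : H) (a : N) : conjChar φ l z a = l (φ z a) := rfl

/-- The intersection of the kernels of the conjugates of a linear character of `N`. -/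
def coreKer (l : N →* ℂˣ) : Subgroup N := ⨅ z : H, (conjChar φ l z).ker

variable {φ} in
theorem mem_coreKer {l : N →* ℂˣ} {a : N} : a ∈ coreKer φ l ↔ ∀ z, l (φ z a) = 1 := by
  simp [coreKer, Subgroup.mem_iInf, MonoidHom.mem_ker, conjChar_apply]

-- If `w ≠ 1` fixes `l`, then `l` is trivial on every `φ w a / a`. Fixed-point-freeness makes `a ↦ φ
-- w a / a` injective, hence surjective on the finite group `N`, so `l = 1`.
variable {φ} in
theorem conjChar_injective [Finite N] (hφ : ∀ h, h ≠ 1 → ∀ a, φ h a = a → a = 1) {l : N →* ℂˣ} (hl : l ≠ 1) :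
    Function.Injective (conjChar φ l) := by
  intro y z hyz
  by_contra hne
  set w := y * z⁻¹ with hw_def
  have hw : w ≠ 1 := fun h => hne (mul_inv_eq_one.mp h)
  have hlw (a : N) : l (φ w a) = l a := by
    have := DFunLike.congr_fun hyz (φ z⁻¹ a)
    simpa [hw_def, conjChar_apply] using this
  let d : N →* N := (φ w).toMonoidHom / MonoidHom.id N
  have hd (a : N) : d a = φ w a / a := rfl
  have hdi : Function.Injective d := (injective_iff_map_eq_one d).mpr fun a ha =>
    hφ w hw a (div_eq_one.mp (by rwa [hd] at ha))
  have hds : Function.Surjective d := Finite.surjective_of_injective hdi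
  refine hl (MonoidHom.ext fun a => ?_)
  obtain ⟨b, rfl⟩ := hds a
  simp [hd, hlw]

variable [Fintype H]

/-- The representation of `N ⋊[φ] H` induced from a linear character of `N`. -/
noncomputable def inducedRep (l : N →* ℂˣ) : Representation ℂ (N ⋊[φ] H) (H → ℂ) where
  toFun g :=
    { toFun := fun f z => (l (φ z g.left) : ℂ) * f (z * g.right)
      map_add' := fun f f' => by ext z; simp [mul_add]
      map_smul' := fun c f => by ext z; simp; ring }
  map_one' := by ext; simp
  map_mul' g h := by
    refine LinearMap.ext fun f => funext fun z => ?_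
    simp [mul_assoc]

theorem inducedRep_apply (l : N →* ℂˣ) (g : N ⋊[φ] H) (f : H → ℂ) (z : H) :
    inducedRep φ l g f z = (l (φ z g.left) : ℂ) * f (z * g.right) := rfl

/-- The character of `N ⋊[φ] H` induced from a linear character of `N`. -/
noncomputable def inducedChar (l : N →* ℂˣ) (g : N ⋊[φ] H) : ℂ :=
  if g.right = 1 then ∑ z : H, (l (φ z g.left) : ℂ) else 0

theorem character_inducedRep (l : N →* ℂˣ) : (inducedRep φ l).character = inducedChar φ l := by
  ext g
  rw [Representation.character, LinearMap.trace_eq_matrix_trace ℂ (Pi.basisFun ℂ H),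
    Matrix.trace, inducedChar]
  simp only [Matrix.diag_apply, LinearMap.toMatrix_apply, Pi.basisFun_apply, Pi.basisFun_repr,
    inducedRep_apply, Pi.single_apply, mul_eq_left]
  split_ifs <;> simp

variable {φ} [Fintype N]

theorem sum_mul_inv_eq_zero {l m : N →* ℂˣ} (h : l ≠ m) :
    ∑ a : N, (l a : ℂ) * ((m a)⁻¹ : ℂˣ) = 0 := by
  have h1 : (Units.coeHom ℂ).comp (l / m) ≠ 1 := by
    intro h1
    refine h (div_eq_one.mp (MonoidHom.ext fun a => Units.ext ?_))
    exact DFunLike.congr_fun h1 a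
  rw [← sum_hom_units_eq_zero _ h1]
  refine Finset.sum_congr rfl fun a _ => ?_
  simp [div_eq_mul_inv]

theorem sum_mul_inv_self (l : N →* ℂˣ) :
    ∑ a : N, (l a : ℂ) * ((l a)⁻¹ : ℂˣ) = Fintype.card N := by
  simp

/-- Restricted to `N`, the space splits into the coordinate lines, on which `N` acts by pairwise
distinct characters. A nonzero invariant subspace thus contains some coordinate line, and `H`
permutes these lines transitively. -/
theorem isIrreducible_inducedRep (hφ : ∀ h, h ≠ 1 → ∀ a, φ h a = a → a = 1) {l : N →* ℂˣ}
    (hl : l ≠ 1) : (inducedRep φ l).IsIrreducible := by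
  have : Nontrivial (Subrepresentation (inducedRep φ l)) := by
    refine ⟨⊥, ⊤, fun h => ?_⟩
    have := congrArg Subrepresentation.toSubmodule h
    exact bot_ne_top (α := Submodule ℂ (H → ℂ)) this
  refine ⟨fun W => or_iff_not_imp_left.mpr fun hW => ?_⟩
  have hW' : W.toSubmodule ≠ ⊥ := fun h => hW (Subrepresentation.toSubmodule_injective h)
  obtain ⟨f, hf, hf0⟩ := Submodule.exists_mem_ne_zero_of_ne_bot hW'
  obtain ⟨z, hz⟩ := Function.ne_iff.mp hf0
  have hsingle : Pi.single z (1 : ℂ) ∈ W.toSubmodule := by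
    -- Up to the factor `|N|`, this sum is the projection of `f` onto the `conjChar φ l z`-isotypic
    -- line.
    have hmem : ∑ a : N, (((conjChar φ l z a)⁻¹ : ℂˣ) : ℂ) •
        inducedRep φ l (SemidirectProduct.inl a) f ∈ W.toSubmodule :=
      Submodule.sum_mem _ fun a _ => Submodule.smul_mem _ _ (W.apply_mem_toSubmodule _ hf)
    have heq : ∑ a : N, (((conjChar φ l z a)⁻¹ : ℂˣ) : ℂ) •
        inducedRep φ l (SemidirectProduct.inl a) f
        = (Fintype.card N * f z : ℂ) • Pi.single z (1 : ℂ) := by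
      ext y
      have h1 : (∑ a : N, (((conjChar φ l z a)⁻¹ : ℂˣ) : ℂ) •
          inducedRep φ l (SemidirectProduct.inl a) f) y =
          (∑ a : N, (conjChar φ l y a : ℂ) * ((conjChar φ l z a)⁻¹ : ℂˣ)) * f y := by
        rw [Finset.sum_apply, Finset.sum_mul]
        refine Finset.sum_congr rfl fun a _ => ?_
        simp only [Pi.smul_apply, smul_eq_mul, inducedRep_apply, SemidirectProduct.left_inl,
          SemidirectProduct.right_inl, mul_one, conjChar_apply]
        ring
      rw [h1]
      by_cases hyz : y = z
      · subst hyz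
        rw [sum_mul_inv_self]
        simp
      · rw [sum_mul_inv_eq_zero fun h => hyz (conjChar_injective hφ hl h)]
        simp [hyz]
    rw [heq] at hmem
    refine (Submodule.smul_mem_iff _ (mul_ne_zero ?_ hz)).mp hmem
    exact_mod_cast Fintype.card_ne_zero
  refine Subrepresentation.toSubmodule_injective (eq_top_iff.mpr fun v _ => ?_)
  rw [pi_eq_sum_univ' v]
  refine Submodule.sum_mem _ fun y _ => Submodule.smul_mem _ _ ?_
  have := W.apply_mem_toSubmodule (SemidirectProduct.inr (y⁻¹ * z)) hsingle
  convert! this using 1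
  ext x
  rw [inducedRep_apply]
  simp only [SemidirectProduct.left_inr, SemidirectProduct.right_inr, map_one, Units.val_one,
    one_mul, Pi.single_apply]
  congr 1
  rw [← mul_assoc, mul_eq_right, mul_inv_eq_one]

theorem inducedChar_mem_Irr (hφ : ∀ h, h ≠ 1 → ∀ a, φ h a = a → a = 1) {l : N →* ℂˣ}
    (hl : l ≠ 1) : inducedChar φ l ∈ Irr (N ⋊[φ] H) :=
  character_inducedRep φ l ▸ character_mem_Irr _ (isIrreducible_inducedRep hφ hl)

/-- Both restrictions to `N` are paired with `l`. If `l` is not conjugate to `m`, the pairing with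
the character induced from `m` vanishes, while that with the one induced from `l` counts the
stabilizer of `l`, which contains 1. -/
theorem exists_eq_conjChar_of_inducedChar_eq {l m : N →* ℂˣ}
    (h : inducedChar φ l = inducedChar φ m) : ∃ z, l = conjChar φ m z := by
  by_contra! hne
  have hsum (k : N →* ℂˣ) : ∑ a : N, inducedChar φ k (SemidirectProduct.inl a) * ((l a)⁻¹ : ℂˣ)
      = ∑ z : H, ∑ a : N, (conjChar φ k z a : ℂ) * ((l a)⁻¹ : ℂˣ) := by
    rw [Finset.sum_comm]
    refine Finset.sum_congr rfl fun a _ => ?_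
    simp [inducedChar, Finset.sum_mul, conjChar_apply]
  have hm := hsum m
  rw [Finset.sum_eq_zero fun z _ => sum_mul_inv_eq_zero (hne z).symm, ← h, hsum l] at hm
  have hcalc : ∑ z : H, ∑ a : N, (conjChar φ l z a : ℂ) * ((l a)⁻¹ : ℂˣ)
      = ((Finset.univ.filter fun z : H => conjChar φ l z = l).card * Fintype.card N : ℕ) := by
    rw [Finset.card_filter, Finset.sum_mul, Nat.cast_sum]
    refine Finset.sum_congr rfl fun z _ => ?_
    split_ifs with hz
    · rw [hz, sum_mul_inv_self]; simp
    · rw [sum_mul_inv_eq_zero hz]; simp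
  rw [hcalc, Nat.cast_eq_zero, mul_eq_zero] at hm
  rcases hm with hm | hm
  · refine absurd (Finset.card_eq_zero.mp hm) (Finset.Nonempty.ne_empty ⟨1, ?_⟩)
    simp only [Finset.mem_filter, Finset.mem_univ, true_and]
    ext a
    simp [conjChar_apply]
  · exact Fintype.card_ne_zero hm

/-- The character vanishes off `N`. On `N` it is a sum of `|H|` roots of unity, which equals `|H|`
only when every term is 1. -/
theorem card_charKer_inducedChar_le (l : N →* ℂˣ) :
    Nat.card (charKer (inducedChar φ l)) ≤ Nat.card (coreKer φ l) := by
  have hone : inducedChar φ l 1 = Fintype.card H := by simp [inducedChar]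
  have key (g : N ⋊[φ] H) (hg : g ∈ charKer (inducedChar φ l)) :
      g.right = 1 ∧ g.left ∈ coreKer φ l := by
    have hg : inducedChar φ l g = inducedChar φ l 1 := hg
    rw [hone, inducedChar] at hg
    split_ifs at hg with hr
    · refine ⟨hr, mem_coreKer.mpr ?_⟩
      have hpow (z : H) : l (φ z g.left) ^ Fintype.card N = 1 := by
        rw [← map_pow, pow_card_eq_one, map_one]
      have hu (z : H) := re_le_one_of_pow_eq_one _ _ Fintype.card_ne_zero (hpow z)
      have hre := congrArg Complex.re hg
      rw [Complex.re_sum, Complex.natCast_re] at hre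
      have hsum : ∑ z : H, (l (φ z g.left) : ℂ).re = ∑ _z : H, (1 : ℝ) := by simp [hre]
      have := (Finset.sum_eq_sum_iff_of_le fun z _ => (hu z).1).mp hsum
      exact fun z => (hu z).2 (this z (Finset.mem_univ z))
    · exact absurd hg.symm (by exact_mod_cast Fintype.card_ne_zero)
  refine Nat.card_le_card_of_injective
    (fun g : charKer (inducedChar φ l) => (⟨g.1.left, (key g.1 g.2).2⟩ : coreKer φ l)) ?_
  rintro ⟨g, hg⟩ ⟨h, hh⟩ hgh
  refine Subtype.ext (SemidirectProduct.ext (congrArg Subtype.val hgh) ?_)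
  rw [(key g hg).1, (key h hh).1]

theorem le_codegree_inducedChar (l : N →* ℂˣ) :
    (Nat.card N : ℝ) / Nat.card (coreKer φ l) ≤ codegree (inducedChar φ l) := by
  have hone : (inducedChar φ l 1).re = Nat.card H := by simp [inducedChar]
  have h1 := card_charKer_inducedChar_le (φ := φ) l
  have hH := Nat.card_pos (α := H)
  have : Finite (N ⋊[φ] H) := Finite.of_equiv _ SemidirectProduct.equivProd.symm
  have : Nonempty (charKer (inducedChar φ l)) := ⟨1, rfl⟩
  have hk := Nat.card_pos (α := charKer (inducedChar φ l))
  rw [codegree, hone, SemidirectProduct.card, Nat.cast_mul, div_right_comm,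
    mul_div_cancel_right₀ _ (by positivity)]
  gcongr

/-- A lower bound for the codegree sum of a Frobenius group with abelian kernel. -/
theorem sum_le_card_mul_Sc (hφ : ∀ h, h ≠ 1 → ∀ a, φ h a = a → a = 1)
    [Fintype (N →* ℂˣ)] :
    ∑ l ∈ (Finset.univ.erase 1 : Finset (N →* ℂˣ)), (Nat.card N : ℝ) / Nat.card (coreKer φ l) ≤
      Nat.card H * Sc (N ⋊[φ] H) := by
  have : Finite (N ⋊[φ] H) := Finite.of_equiv _ SemidirectProduct.equivProd.symm
  have hfin := irr_finite (N ⋊[φ] H)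
  rw [Sc, finsum_mem_eq_finite_toFinset_sum _ hfin, Finset.mul_sum]
  calc _ ≤ ∑ l ∈ Finset.univ.erase 1, codegree (inducedChar φ l) :=
        Finset.sum_le_sum fun l _ => le_codegree_inducedChar l
    _ = ∑ χ ∈ hfin.toFinset, ∑ l ∈ (Finset.univ.erase 1).filter (inducedChar φ · = χ),
          codegree (inducedChar φ l) := by
        refine (Finset.sum_fiberwise_of_maps_to (fun l hl => ?_) _).symm
        exact hfin.mem_toFinset.mpr (inducedChar_mem_Irr hφ (Finset.ne_of_mem_erase hl))
    _ ≤ _ := by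
        refine Finset.sum_le_sum fun χ hχ => ?_
        rw [Finset.sum_congr rfl fun l hl => by rw [(Finset.mem_filter.mp hl).2],
          Finset.sum_const, nsmul_eq_mul]
        refine mul_le_mul_of_nonneg_right ?_ (codegree_nonneg (hfin.mem_toFinset.mp hχ))
        rw [Nat.cast_le]
        rcases (Finset.filter (inducedChar φ · = χ) (Finset.univ.erase 1)).eq_empty_or_nonempty
          with he | ⟨m, hm⟩
        · simp [he]
        · rw [Nat.card_eq_fintype_card, ← Finset.card_univ]
          -- A fibre of induction lies in a single `H`-orbit of linear characters, so it has at most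
          -- `|H|` elements.
          refine (Finset.card_le_card (t := Finset.univ.image (conjChar φ m))
            fun l hl => ?_).trans Finset.card_image_le
          obtain ⟨z, hz⟩ := exists_eq_conjChar_of_inducedChar_eq
            ((Finset.mem_filter.mp hl).2.trans (Finset.mem_filter.mp hm).2.symm)
          exact Finset.mem_image.mpr ⟨z, Finset.mem_univ _, hz.symm⟩

end Induced

end CodegreeSum

namespace CodegreeSum

/-! ### Invariant subgroups and orders of linear characters -/

section Exponent

variable {N H : Type*} [CommGroup N] [Finite N] [Group H]

/-- A `3`-group acting without nontrivial fixed points on a finite group: every invariant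
subgroup has order `1` modulo `3`. -/
theorem card_modEq_one_of_fixedPointFree (hH : IsPGroup 3 H) {φ : H →* MulAut N}
    (hfix : ∀ a, (∀ h, φ h a = a) → a = 1) (K : Subgroup N) (hK : ∀ h, ∀ a ∈ K, φ h a ∈ K) :
    Nat.card K ≡ 1 [MOD 3] := by
  let _ : MulAction H K :=
    { smul := fun h a => ⟨φ h a, hK h a a.2⟩
      one_smul := fun a => Subtype.ext (by change φ 1 (a : N) = a; simp)
      mul_smul := fun g h a => Subtype.ext (by
        change φ (g * h) (a : N) = φ g (φ h (a : N)); simp) }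
  have hsmul (h : H) (a : K) : ((h • a : K) : N) = φ h a := rfl
  have : Fact (Nat.Prime 3) := ⟨Nat.prime_three⟩
  have h1 := hH.card_modEq_card_fixedPoints K
  have h2 : MulAction.fixedPoints H K = {1} := by
    ext a
    simp only [MulAction.mem_fixedPoints, Set.mem_singleton_iff]
    constructor
    · exact fun h => Subtype.ext (hfix a fun g => by rw [← hsmul, h g])
    · rintro rfl g
      exact Subtype.ext (by rw [hsmul]; simp)
  rw [h2] at h1
  simpa using h1

/-- In a finite abelian group whose order is the square of a squarefree number, a subgroup of
exponent dividing a prime `p` has order dividing `p ^ 2`. -/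
theorem card_dvd_sq_of_pow_eq_one {e p : ℕ} (hp : p.Prime) (he : Squarefree e)
    (hN : Nat.card N = e ^ 2) (K : Subgroup N) (hK : ∀ a ∈ K, a ^ p = 1) :
    Nat.card K ∣ p ^ 2 := by
  have : Fact p.Prime := ⟨hp⟩
  have hpg : IsPGroup p K := fun a => ⟨1, Subtype.ext (by simpa using hK a a.2)⟩
  obtain ⟨j, hj⟩ := IsPGroup.iff_card.mp hpg
  have hd : p ^ j ∣ e ^ 2 := hj ▸ hN ▸ K.card_subgroup_dvd_card
  rw [hj]
  refine pow_dvd_pow p ?_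
  have he0 : e ≠ 0 := he.ne_zero
  have h1 := (hp.pow_dvd_iff_le_factorization (pow_ne_zero 2 he0)).mp hd
  rw [Nat.factorization_pow, Finsupp.smul_apply, smul_eq_mul] at h1
  have := he.natFactorization_le_one p
  omega

/-- Suppose `p` divides both numbers. The `p`-torsion `K` of the core has order 1, `p` or `p²`.
Cauchy's theorem excludes 1, and the congruence modulo 3 excludes `p`. If the order is `p²`, then
`l` kills the whole `p`-torsion `T` of `N`, so `l ^ (e / p) = 1`, and `p ∣ e / p` contradicts
squarefreeness. -/
theorem coprime_card_coreKer_orderOf (hH : IsPGroup 3 H) {φ : H →* MulAut N}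
    (hfix : ∀ a, (∀ h, φ h a = a) → a = 1) {e : ℕ} (he : Squarefree e)
    (hN : Nat.card N = e ^ 2) (hexp : ∀ a : N, a ^ e = 1)
    (hmod : ∀ p, p.Prime → p ∣ e → p % 3 = 2) (l : N →* ℂˣ) :
    (Nat.card (coreKer φ l)).Coprime (orderOf l) := by
  have hle : l ^ e = 1 := MonoidHom.ext fun a => by
    rw [MonoidHom.pow_apply, ← map_pow, hexp, map_one, MonoidHom.one_apply]
  refine Nat.Coprime.symm (Nat.coprime_of_dvd fun p hp hpl hpK => ?_)
  have : Fact p.Prime := ⟨hp⟩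
  have hpe : p ∣ e := hpl.trans (orderOf_dvd_of_pow_eq_one hle)
  let T : Subgroup N := (powMonoidHom p).ker
  have hT (a : N) : a ∈ T ↔ a ^ p = 1 := by simp [T, MonoidHom.mem_ker]
  let K := coreKer φ l ⊓ T
  have hcard3 : Nat.card K ≡ 1 [MOD 3] := by
    refine card_modEq_one_of_fixedPointFree hH hfix K fun h a ha => ⟨?_, ?_⟩
    · refine mem_coreKer.mpr fun z => ?_
      have := mem_coreKer.mp ha.1 (z * h)
      simpa using this
    · have := (hT a).mp ha.2
      exact (hT _).mpr (by rw [← map_pow, this, map_one])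
  have hKdvd := card_dvd_sq_of_pow_eq_one hp he hN K fun a ha => (hT a).mp ha.2
  have hTdvd := card_dvd_sq_of_pow_eq_one hp he hN T fun a ha => (hT a).mp ha
  obtain ⟨j, hj, hKj⟩ := (Nat.dvd_prime_pow hp).mp hKdvd
  have hp3 := hmod p hp hpe
  have hne1 : Nat.card K ≠ 1 := by
    obtain ⟨x, hx⟩ := exists_prime_orderOf_dvd_card' p hpK
    intro h1
    have hxK : (x : N) ∈ K := ⟨x.2, (hT _).mpr (by
      rw [← hx, ← Subgroup.coe_pow, pow_orderOf_eq_one, Subgroup.coe_one])⟩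
    rw [Subgroup.card_eq_one.mp h1, Subgroup.mem_bot] at hxK
    have : x = 1 := Subtype.ext hxK
    rw [this, orderOf_one] at hx
    exact hp.one_lt.ne hx
  have hKT : K = T := by
    refine Subgroup.eq_of_le_of_card_ge inf_le_right ?_
    have hj2 : j = 2 := by
      interval_cases j
      · exact absurd (by simpa using hKj) hne1
      · rw [hKj, pow_one] at hcard3
        unfold Nat.ModEq at hcard3
        omega
      · rfl
    rw [hKj, hj2]
    exact Nat.le_of_dvd (by have := hp.pos; positivity) hTdvd
  obtain ⟨k, rfl⟩ := hpe
  have hlk : l ^ k = 1 := MonoidHom.ext fun a => by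
    -- Here `e = p * k`, so every `k`-th power is `p`-torsion.
    have ha : a ^ k ∈ K := hKT ▸ (hT _).mpr (by rw [← pow_mul, mul_comm, hexp])
    have := mem_coreKer.mp ha.1 1
    rw [MonoidHom.pow_apply, ← map_pow, MonoidHom.one_apply]
    simpa using this
  have hpk : p ∣ k := hpl.trans (orderOf_dvd_of_pow_eq_one hlk)
  exact hp.not_isUnit (he p (mul_dvd_mul_left p hpk))

/-- Both `(orderOf l) ^ 2` and the order of the core divide `|N| = e ^ 2`. Being coprime, they have
a product dividing it too. -/
theorem orderOf_sq_le_card_div_card_coreKer (hH : IsPGroup 3 H) {φ : H →* MulAut N}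
    (hfix : ∀ a, (∀ h, φ h a = a) → a = 1) {e : ℕ} (he : Squarefree e)
    (hN : Nat.card N = e ^ 2) (hexp : ∀ a : N, a ^ e = 1)
    (hmod : ∀ p, p.Prime → p ∣ e → p % 3 = 2) (l : N →* ℂˣ) :
    (orderOf l : ℝ) ^ 2 ≤ (Nat.card N : ℝ) / Nat.card (coreKer φ l) := by
  have hcop := coprime_card_coreKer_orderOf hH hfix he hN hexp hmod l
  have hle : l ^ e = 1 := MonoidHom.ext fun a => by
    rw [MonoidHom.pow_apply, ← map_pow, hexp, map_one, MonoidHom.one_apply]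
  have h1 : orderOf l ^ 2 ∣ Nat.card N := hN ▸ pow_dvd_pow_of_dvd (orderOf_dvd_of_pow_eq_one hle) 2
  have h2 := (hcop.pow_right 2).symm.mul_dvd_of_dvd_of_dvd h1
    (coreKer φ l).card_subgroup_dvd_card
  have hk := Nat.card_pos (α := coreKer φ l)
  rw [le_div_iff₀ (by positivity)]
  exact_mod_cast Nat.le_of_dvd Nat.card_pos h2

/-- In a product of groups of distinct prime exponents `p i`, the order of an element is at least
the product of the `p i` over its nontrivial coordinates. -/
theorem prod_ite_le_orderOf {ι : Type*} [Fintype ι] {A : ι → Type*} [∀ i, Group (A i)]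
    [∀ i, Finite (A i)] [∀ i, DecidableEq (A i)] {p : ι → ℕ} (hp : ∀ i, (p i).Prime)
    (hinj : Function.Injective p) (hexp : ∀ i, ∀ a : A i, a ^ p i = 1) (a : ∀ i, A i) :
    ∏ i, (if a i = 1 then 1 else p i) ≤ orderOf a := by
  refine Nat.le_of_dvd (orderOf_pos a) (Fintype.prod_dvd_of_isRelPrime ?_ fun i => ?_)
  · intro i j hij
    have := (Nat.coprime_primes (hp i) (hp j)).mpr (hinj.ne hij)
    change IsRelPrime _ _
    rw [← Nat.coprime_iff_isRelPrime]
    beta_reduce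
    split_ifs <;> first | exact this | simp
  · split_ifs with h
    · exact one_dvd _
    · have : Fact (p i).Prime := ⟨hp i⟩
      rw [← orderOf_eq_prime (hexp i (a i)) h]
      exact orderOf_map_dvd (Pi.evalMonoidHom A i) a

/-- Each factor on the left is a sum over `A i` with weight 1 at the identity and `p i ^ 2` at the
other `p i ^ 2 - 1` elements. Expanding the product gives a sum over tuples, bounded term by term.
-/
theorem prod_le_sum_orderOf_sq {ι : Type*} [Fintype ι] {A : ι → Type*} [∀ i, Group (A i)]
    [∀ i, Fintype (A i)] [Fintype (∀ i, A i)] {p : ι → ℕ} (hp : ∀ i, (p i).Prime)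
    (hinj : Function.Injective p) (hexp : ∀ i, ∀ a : A i, a ^ p i = 1)
    (hcard : ∀ i, Fintype.card (A i) = p i ^ 2) :
    ∏ i, (1 + ((p i : ℝ) ^ 2 - 1) * (p i : ℝ) ^ 2) ≤ ∑ a : ∀ i, A i, (orderOf a : ℝ) ^ 2 := by
  classical
  have h1 (i : ι) : (1 + ((p i : ℝ) ^ 2 - 1) * (p i : ℝ) ^ 2) =
      ∑ a : A i, ((if a = 1 then 1 else p i : ℕ) : ℝ) ^ 2 := by
    rw [← Finset.add_sum_erase _ _ (Finset.mem_univ 1), Finset.sum_congr rfl fun a ha => by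
      rw [if_neg (Finset.ne_of_mem_erase ha)], Finset.sum_const,
      Finset.card_erase_of_mem (Finset.mem_univ 1), Finset.card_univ, hcard, nsmul_eq_mul,
      Nat.cast_sub (Nat.one_le_pow _ _ (hp i).pos)]
    simp
  rw [Finset.prod_congr rfl fun i _ => h1 i, Finset.prod_univ_sum, Fintype.piFinset_univ]
  refine le_trans (le_of_eq ?_) (Finset.sum_le_sum fun a _ =>
    pow_le_pow_left₀ (by positivity) (Nat.cast_le.mpr (prod_ite_le_orderOf hp hinj hexp a)) 2)
  refine Finset.sum_congr (by ext; simp) fun a _ => ?_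
  rw [Nat.cast_prod, Finset.prod_pow]

end Exponent

/-! ### Sums of element orders in cyclic groups -/

section Cyclic

/-- The sum of the orders of the elements of a cyclic group of order `n`. -/
def sumOrders (n : ℕ) : ℕ := ∑ d ∈ n.divisors, d * d.totient

theorem sum_orderOf_of_isCyclic (G : Type*) [Group G] [Fintype G] [IsCyclic G] :
    ∑ g : G, orderOf g = sumOrders (Nat.card G) := by
  classical
  rw [← Finset.sum_fiberwise_of_maps_to (s := Finset.univ) (t := (Nat.card G).divisors)
    (g := fun g : G => orderOf g)]
  · refine Finset.sum_congr rfl fun d hd => ?_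
    rw [Finset.sum_congr rfl fun g hg => (Finset.mem_filter.mp hg).2, Finset.sum_const,
      IsCyclic.card_orderOf_eq_totient, smul_eq_mul, mul_comm]
    rw [← Nat.card_eq_fintype_card]
    exact Nat.dvd_of_mem_divisors hd
  · exact fun g _ => Nat.mem_divisors.mpr ⟨orderOf_dvd_natCard g, Nat.card_pos.ne'⟩

theorem sumOrders_mul {m n : ℕ} (h : m.Coprime n) :
    sumOrders (m * n) = sumOrders m * sumOrders n := by
  let f : ArithmeticFunction ℕ := ⟨fun d => d * d.totient, by simp⟩
  have hf : f.IsMultiplicative := ⟨by simp [f], fun {a b} hab => by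
    simp only [f, ArithmeticFunction.coe_mk, Nat.totient_mul hab]
    ring⟩
  have hs (k : ℕ) : sumOrders k = (f * ArithmeticFunction.zeta) k := by
    rw [ArithmeticFunction.mul_zeta_apply]
    rfl
  rw [hs, hs, hs]
  exact (hf.mul ArithmeticFunction.isMultiplicative_zeta).map_mul_of_coprime h

theorem sumOrders_prod {ι : Type*} (s : Finset ι) (f : ι → ℕ)
    (h : (s : Set ι).Pairwise (Function.onFun Nat.Coprime f)) :
    sumOrders (∏ i ∈ s, f i) = ∏ i ∈ s, sumOrders (f i) := by
  classical
  induction s using Finset.induction_on with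
  | empty => simp [sumOrders]
  | insert i s hi ih =>
    rw [Finset.prod_insert hi, Finset.prod_insert hi, sumOrders_mul, ih]
    · exact h.mono (by simp)
    · exact Nat.Coprime.prod_right fun j hj => h (by simp) (by simp [hj]) (by rintro rfl; exact hi hj)

theorem sumOrders_prime_sq {p : ℕ} (hp : p.Prime) :
    (sumOrders (p ^ 2) : ℝ) = 1 + (p - 1) * p + (p ^ 2 - p) * p ^ 2 := by
  rw [sumOrders, Nat.sum_divisors_prime_pow hp]
  have h1 := Nat.totient_prime_pow hp (n := 1) one_pos
  have h2 := Nat.totient_prime_pow hp (n := 2) two_pos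
  simp only [Finset.sum_range_succ, h1, h2, Finset.sum_range_zero, pow_zero, Nat.totient_one]
  push_cast [Nat.cast_sub hp.one_le]
  simp
  ring

theorem sumOrders_three : sumOrders 3 = 7 := by decide

end Cyclic

end CodegreeSum

namespace CodegreeSum

/-- The abelian group `C_{p₁}² × ⋯ × C_{pₜ}²`. -/
abbrev Kernel (t : ℕ) : Type := (i : Fin t) → C (prime23 i) × C (prime23 i)

instance (i : ℕ) : Fact (prime23 i).Prime := ⟨prime_prime23 i⟩

theorem pow_prime23_eq_one (i : ℕ) (a : C (prime23 i) × C (prime23 i)) : a ^ prime23 i = 1 := by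
  have h (x : C (prime23 i)) : x ^ prime23 i = 1 := by
    have := pow_card_eq_one (x := x)
    rwa [Fintype.card_multiplicative, ZMod.card] at this
  exact Prod.ext (h _) (h _)

/-! ### The class of examples: Frobenius structure and existence -/

section Structure

theorem isPGroup_C_three : IsPGroup 3 (C 3) := IsPGroup.of_card (n := 1) (by simp)

/-- Any nontrivial element generates `C 3`, so a point it fixes is fixed by the whole group. -/
theorem eq_one_of_apply_eq_self {N : Type*} [Group N] {φ : C 3 →* MulAut N}
    (hfix : ∀ a, (∀ h, φ h a = a) → a = 1) (h : C 3) (hh : h ≠ 1) (a : N) (ha : φ h a = a) :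
    a = 1 := by
  refine hfix a fun g => ?_
  have : Fact (Nat.Prime 3) := ⟨Nat.prime_three⟩
  obtain ⟨k, rfl⟩ := Subgroup.mem_zpowers_iff.mp
    (mem_zpowers_of_prime_card (p := 3) (g' := g) (by simp) hh)
  have h1 : φ h ∈ MulAction.stabilizer (MulAut N) a := ha
  rw [map_zpow]
  exact Subgroup.zpow_mem _ h1 k

/-- The members of the class `𝒢ₜ` are semidirect products with a fixed-point-free action. -/
theorem IsExample.exists_mulEquiv {t : ℕ} {G : Type*} [Group G] (h : IsExample t G) :
    ∃ φ : C 3 →* MulAut (Kernel t), (∀ a, (∀ h, φ h a = a) → a = 1) ∧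
      Nonempty (Kernel t ⋊[φ] C 3 ≃* G) := by
  obtain ⟨A, P, hA, hAP, ⟨fP⟩, ⟨fA⟩, hcent⟩ := h
  -- The action is conjugation of `P` on `A`, transported along the given isomorphisms.
  refine ⟨_, ?_, ⟨(SemidirectProduct.congr' fA fP).symm.trans
    (SemidirectProduct.mulEquivSubgroup hAP)⟩⟩
  intro a ha
  have hmem : ((fA.symm a : A) : G) ∈ A ⊓ Subgroup.centralizer (P : Set G) := by
    refine ⟨(fA.symm a).2, Subgroup.mem_centralizer_iff.mpr fun p hp => ?_⟩
    have h1 := congrArg fA.symm (ha (fP ⟨p, hp⟩))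
    simp only [MonoidHom.comp_apply, MonoidHom.coe_coe, MulEquiv.symm_apply_apply,
      MulAut.congr_apply, MulEquiv.trans_apply] at h1
    have h2 : p * (fA.symm a : G) * p⁻¹ = fA.symm a := congrArg Subtype.val h1
    exact mul_inv_eq_iff_eq_mul.mp h2
  rw [hcent, Subgroup.mem_bot] at hmem
  have : fA.symm a = 1 := Subtype.ext hmem
  simpa using this

/-- The automorphism `(x, y) ↦ (y⁻¹, x y⁻¹)` of order `3` of each factor. -/
noncomputable def rotate (t : ℕ) : MulAut (Kernel t) where
  toFun a i := ((a i).2⁻¹, (a i).1 * (a i).2⁻¹)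
  invFun a i := ((a i).2 * (a i).1⁻¹, (a i).1⁻¹)
  left_inv a := by ext i <;> simp
  right_inv a := by ext i <;> simp
  map_mul' a b := by
    ext i
    · simp [mul_comm]
    · simp [mul_mul_mul_comm, mul_comm]

theorem rotate_apply (t : ℕ) (a : Kernel t) (i : Fin t) :
    rotate t a i = ((a i).2⁻¹, (a i).1 * (a i).2⁻¹) := rfl

theorem rotate_pow_three (t : ℕ) : rotate t ^ 3 = 1 := by
  ext a i <;> simp [pow_succ, rotate_apply]

/-- The action of `C_3` on `C_{p₁}² × ⋯ × C_{pₜ}²` by rotations. -/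
noncomputable def rotateHom (t : ℕ) : C 3 →* MulAut (Kernel t) where
  toFun h := rotate t ^ h.toAdd.val
  map_one' := by simp
  map_mul' g h := by
    rw [toAdd_mul, ZMod.val_add, ← pow_eq_pow_mod _ (rotate_pow_three t), pow_add]

/-- A fixed pair satisfies `x = y⁻¹` and `y = x y⁻¹`, hence `y ^ 3 = 1`. Since `y ^ p = 1` with `p ≠
3`, it is trivial. -/
theorem eq_one_of_rotate_eq_self {t : ℕ} {a : Kernel t} (ha : rotate t a = a) : a = 1 := by
  funext i
  have hi := congrFun ha i
  rw [rotate_apply, Prod.ext_iff] at hi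
  obtain ⟨h1, h2⟩ := hi
  simp only at h1 h2
  have h3 : (a i).2 ^ 3 = 1 := by
    rw [← h1, ← mul_inv, inv_eq_iff_mul_eq_one] at h2
    rw [pow_three', h2]
  have h4 : (a i).2 ^ prime23 i = 1 := congrArg Prod.snd (pow_prime23_eq_one i (a i))
  have hcop : Nat.Coprime 3 (prime23 i) :=
    (Nat.Prime.coprime_iff_not_dvd Nat.prime_three).mpr fun hd => by
      have := prime23_mod_three i
      omega
  have h5 : (a i).2 = 1 := by
    have := pow_gcd_eq_one.mpr ⟨h3, h4⟩
    rwa [hcop, pow_one] at this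
  refine Prod.ext ?_ h5
  rw [← h1, h5]
  simp

theorem isExample_semidirectProduct (t : ℕ) :
    IsExample t (Kernel t ⋊[rotateHom t] C 3) := by
  refine ⟨SemidirectProduct.inl.range, SemidirectProduct.inr.range, ?_, ?_,
    ⟨(MonoidHom.ofInjective SemidirectProduct.inr_injective).symm⟩,
    ⟨(MonoidHom.ofInjective SemidirectProduct.inl_injective).symm⟩, ?_⟩
  · rw [SemidirectProduct.range_inl_eq_ker_rightHom]
    infer_instance
  · refine Subgroup.isComplement'_of_disjoint_and_mul_eq_univ ?_ ?_
    · rw [Subgroup.disjoint_def]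
      rintro _ ⟨a, rfl⟩ ⟨h, hh⟩
      have := congrArg SemidirectProduct.left hh
      simp only [SemidirectProduct.left_inr, SemidirectProduct.left_inl] at this
      rw [← this, map_one]
    · exact Set.eq_univ_of_forall fun g => Set.mem_mul.mpr
        ⟨_, ⟨g.left, rfl⟩, _, ⟨g.right, rfl⟩, SemidirectProduct.inl_left_mul_inr_right g⟩
  · rw [eq_bot_iff]
    rintro _ ⟨⟨a, rfl⟩, ha⟩
    have h1 := Subgroup.mem_centralizer_iff.mp ha (SemidirectProduct.inr (Multiplicative.ofAdd 1))
      ⟨_, rfl⟩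
    have h2 : 1 * rotateHom t (Multiplicative.ofAdd 1) a = a * rotateHom t 1 1 :=
      congrArg SemidirectProduct.left h1
    have h3 : rotate t a = a := by simpa [rotateHom, ZMod.val_one] using h2
    rw [eq_one_of_rotate_eq_self h3, map_one]
    exact Subgroup.mem_bot.mpr rfl

end Structure

/-! ### Comparison of the two codegree sums -/

section Bounds

/-- The product of the first `t` primes congruent to `2` modulo `3`. -/
noncomputable def primorial23 (t : ℕ) : ℕ := ∏ i : Fin t, prime23 i

theorem prime23_fin_injective (t : ℕ) : Function.Injective fun i : Fin t => prime23 i :=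
  prime23_injective.comp Fin.val_injective

theorem squarefree_primorial23 (t : ℕ) : Squarefree (primorial23 t) := by
  refine Finset.squarefree_prod_of_pairwise_isCoprime ?_ fun i _ => (prime_prime23 i).squarefree
  intro i _ j _ hij
  exact Nat.coprime_iff_isRelPrime.mp
    ((Nat.coprime_primes (prime_prime23 i) (prime_prime23 j)).mpr
      ((prime23_fin_injective t).ne hij))

theorem card_kernel (t : ℕ) : Nat.card (Kernel t) = primorial23 t ^ 2 := by
  simp [primorial23, sq, Finset.prod_mul_distrib]

theorem pow_primorial23_eq_one (t : ℕ) (a : Kernel t) : a ^ primorial23 t = 1 := by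
  funext i
  obtain ⟨k, hk⟩ : prime23 i ∣ primorial23 t :=
    Finset.dvd_prod_of_mem (fun i : Fin t => prime23 i) (Finset.mem_univ i)
  rw [Pi.pow_apply, hk, pow_mul, pow_prime23_eq_one, one_pow, Pi.one_apply]

theorem mod_three_of_prime_dvd_primorial23 {t p : ℕ} (hp : p.Prime) (h : p ∣ primorial23 t) :
    p % 3 = 2 := by
  obtain ⟨i, -, hi⟩ := (hp.prime.dvd_finsetProd_iff _).mp h
  rw [(Nat.prime_dvd_prime_iff_eq hp (prime_prime23 i)).mp hi]
  exact prime23_mod_three i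

/-- The factor 3 is the order of the complement, and the subtracted 1 is the term of the trivial
character, which does not induce irreducibly. -/
theorem le_Sc_of_isExample {t : ℕ} {G : Type*} [Group G] (h : IsExample t G) :
    ∏ i : Fin t, (1 + ((prime23 i : ℝ) ^ 2 - 1) * (prime23 i : ℝ) ^ 2) - 1 ≤ 3 * Sc G := by
  classical
  obtain ⟨φ, hfix, ⟨e⟩⟩ := h.exists_mulEquiv
  have d := (CommGroup.monoidHom_mulEquiv_of_hasEnoughRootsOfUnity (Kernel t) ℂ).some
  have : Finite (Kernel t →* ℂˣ) := d.toEquiv.finite_iff.mpr inferInstance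
  have := Fintype.ofFinite (Kernel t →* ℂˣ)
  rw [← Sc_congr e]
  have h1 := sum_le_card_mul_Sc (φ := φ) (eq_one_of_apply_eq_self hfix)
  rw [show Nat.card (C 3) = 3 by simp] at h1
  refine le_trans ?_ h1
  have h2 := prod_le_sum_orderOf_sq (A := fun i : Fin t => C (prime23 i) × C (prime23 i))
    (p := fun i : Fin t => prime23 i) (fun i => prime_prime23 i) (prime23_fin_injective t)
    (fun i => pow_prime23_eq_one i) (fun i => by simp [sq])
  refine (sub_le_sub_right h2 1).trans ?_
  have h3 : ∑ a : Kernel t, (orderOf a : ℝ) ^ 2 = ∑ l : Kernel t →* ℂˣ, (orderOf l : ℝ) ^ 2 := by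
    rw [← Equiv.sum_comp d.toEquiv]
    exact Finset.sum_congr rfl fun l _ => by
      rw [show orderOf (d.toEquiv l) = orderOf l from MulEquiv.orderOf_eq d l]
  rw [h3, ← Finset.add_sum_erase _ _ (Finset.mem_univ 1), orderOf_one]
  simp only [Nat.cast_one, one_pow, add_sub_cancel_left]
  exact Finset.sum_le_sum fun l _ => orderOf_sq_le_card_div_card_coreKer isPGroup_C_three hfix
    (squarefree_primorial23 t) (card_kernel t) (pow_primorial23_eq_one t)
    (fun p hp hd => mod_three_of_prime_dvd_primorial23 hp hd) l

theorem card_of_isExample {t : ℕ} {G : Type*} [Group G] (h : IsExample t G) :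
    Nat.card G = 3 * ∏ i : Fin t, prime23 i ^ 2 := by
  obtain ⟨φ, -, ⟨e⟩⟩ := h.exists_mulEquiv
  rw [← Nat.card_congr e.toEquiv, SemidirectProduct.card, card_kernel, primorial23,
    Finset.prod_pow, mul_comm]
  simp

theorem finite_of_isExample {t : ℕ} {G : Type*} [Group G] (h : IsExample t G) : Finite G := by
  refine Nat.finite_of_card_ne_zero ?_
  rw [card_of_isExample h]
  exact mul_ne_zero three_ne_zero
    (Finset.prod_ne_zero_iff.mpr fun i _ => pow_ne_zero 2 (prime_prime23 i).ne_zero)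

theorem Sc_C_le (n : ℕ) [NeZero n] : Sc (C n) ≤ sumOrders n := by
  refine (Sc_le_sum_orderOf_of_isCyclic (C n)).trans_eq ?_
  rw [← Nat.cast_sum, sum_orderOf_of_isCyclic]
  simp

theorem sumOrders_card (t : ℕ) :
    (sumOrders (3 * ∏ i : Fin t, prime23 i ^ 2) : ℝ) = 7 * ∏ i : Fin t,
      (1 + ((prime23 i : ℝ) - 1) * prime23 i + ((prime23 i : ℝ) ^ 2 - prime23 i) *
        (prime23 i : ℝ) ^ 2) := by
  rw [sumOrders_mul, sumOrders_three, sumOrders_prod]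
  · push_cast
    congr 1
    exact Finset.prod_congr rfl fun i _ => sumOrders_prime_sq (prime_prime23 i)
  · intro i _ j _ hij
    exact Nat.Coprime.pow 2 2 ((Nat.coprime_primes (prime_prime23 i) (prime_prime23 j)).mpr
      ((prime23_fin_injective t).ne hij))
  · refine Nat.Coprime.prod_right fun i _ => Nat.Coprime.pow_right 2
      ((Nat.Prime.coprime_iff_not_dvd Nat.prime_three).mpr fun hd => ?_)
    have := prime23_mod_three i
    omega

theorem one_add_sum_le_prod_one_add {ι : Type*} (s : Finset ι) (f : ι → ℝ) (hf : ∀ i, 0 ≤ f i) :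
    1 + ∑ i ∈ s, f i ≤ ∏ i ∈ s, (1 + f i) := by
  classical
  induction s using Finset.induction_on with
  | empty => simp
  | insert i s hi ih =>
    rw [Finset.sum_insert hi, Finset.prod_insert hi]
    have h1 := Finset.sum_nonneg fun j (_ : j ∈ s) => hf j
    nlinarith [hf i, mul_nonneg (hf i) h1, mul_le_mul_of_nonneg_left ih (hf i)]

/-- The right side exceeds the first factor on the left by `p (p - 1)²`, while the added term is at
most `p³ / 4`. The constant `1 / 4` makes this suffice exactly from `p = 2` on. -/
theorem mul_one_add_le (p : ℝ) (hp : 2 ≤ p) :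
    (1 + (p - 1) * p + (p ^ 2 - p) * p ^ 2) * (1 + 1 / 4 * (1 / p)) ≤ 1 + (p ^ 2 - 1) * p ^ 2 := by
  have h0 : 0 < p := by linarith
  have h1 : 1 + (p - 1) * p + (p ^ 2 - p) * p ^ 2 ≤ p ^ 4 := by
    nlinarith [mul_nonneg (by linarith : 0 ≤ p - 1) (sq_nonneg p)]
  have h2 : (1 + (p - 1) * p + (p ^ 2 - p) * p ^ 2) * (1 / p) ≤ p ^ 3 := by
    rw [mul_one_div, div_le_iff₀ h0]
    linarith [pow_succ p 3]
  -- This uses `4 (p - 1)² - p² = (p - 2) (3 p - 2)`.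
  nlinarith [mul_nonneg h0.le (mul_nonneg (by linarith : 0 ≤ p - 2) (by linarith : 0 ≤ 3 * p - 2))]

theorem sum_one_div_le_ratio {t : ℕ} {G : Type*} [Group G] (h : IsExample t G) :
    (∑ i : Fin t, (1 : ℝ) / prime23 i) / 84 ≤ Sc G / Sc (C (Nat.card G)) := by
  have := finite_of_isExample h
  have : NeZero (Nat.card G) := ⟨Nat.card_pos.ne'⟩
  have hlow := le_Sc_of_isExample h
  have hup := Sc_C_le (Nat.card G)
  have hpos := Sc_pos_of_comm (C (Nat.card G))
  set s : ℝ := ∑ i : Fin t, (1 : ℝ) / prime23 i with hs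
  have hs0 : 0 ≤ s := Finset.sum_nonneg fun i _ => by positivity
  rw [card_of_isExample h, sumOrders_card, ← card_of_isExample h] at hup
  set Q : ℝ := ∏ i : Fin t, (1 + ((prime23 i : ℝ) - 1) * prime23 i +
    ((prime23 i : ℝ) ^ 2 - prime23 i) * (prime23 i : ℝ) ^ 2) with hQ
  have hp2 (i : Fin t) : (2 : ℝ) ≤ prime23 i := by exact_mod_cast (prime_prime23 i).two_le
  have hfac (i : Fin t) : 1 ≤ 1 + ((prime23 i : ℝ) - 1) * prime23 i +
      ((prime23 i : ℝ) ^ 2 - prime23 i) * (prime23 i : ℝ) ^ 2 := by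
    have := hp2 i
    have h1 : 0 ≤ ((prime23 i : ℝ) - 1) * prime23 i := by nlinarith
    nlinarith [mul_nonneg h1 (sq_nonneg (prime23 i : ℝ))]
  have hQ1 : 1 ≤ Q := by
    refine (Finset.prod_const_one (s := (Finset.univ : Finset (Fin t)))).symm.trans_le ?_
    exact Finset.prod_le_prod (fun _ _ => zero_le_one) fun i _ => hfac i
  have hprod : Q * (1 + 1 / 4 * s) ≤
      ∏ i : Fin t, (1 + ((prime23 i : ℝ) ^ 2 - 1) * (prime23 i : ℝ) ^ 2) := by
    refine le_trans ?_ (Finset.prod_le_prod (fun i _ => ?_) fun i _ =>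
      mul_one_add_le (prime23 i : ℝ) (hp2 i))
    · rw [Finset.prod_mul_distrib, hs, Finset.mul_sum]
      exact mul_le_mul_of_nonneg_left
        (one_add_sum_le_prod_one_add _ _ fun i => by positivity) (by linarith)
    · exact mul_nonneg (by linarith [hfac i]) (by positivity)
  rw [le_div_iff₀ hpos]
  -- From `3 * Sc G ≥ Q (1 + s / 4) - 1 ≥ Q s / 4` and `Sc (C n) ≤ 7 Q` comes the constant `84 = 3 ·
  -- 7 · 4`.
  nlinarith [mul_le_mul_of_nonneg_left hup hs0]

end Bounds

end CodegreeSum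

theorem theorem4p1 :
    -- such groups exist for every `t`
    (∀ t : ℕ, ∃ (G : Type) (_ : Group G), CodegreeSum.IsExample t G) ∧
    -- the ratio tends to infinity with `t`, whatever the choice of the groups
    (∀ M : ℝ, ∃ T : ℕ, ∀ t : ℕ, T ≤ t → ∀ (G : Type*) [Group G], CodegreeSum.IsExample t G →
      M ≤ CodegreeSum.Sc G / CodegreeSum.Sc (CodegreeSum.C (Nat.card G))) ∧
    -- a group of order `n` whose codegree sum exceeds that of the cyclic group of order `n`
    (∃ (n : ℕ) (G : Type) (_ : Group G), Finite G ∧ Nat.card G = n ∧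
      CodegreeSum.Sc (CodegreeSum.C n) < CodegreeSum.Sc G) := by
  refine ⟨fun t => ⟨_, _, CodegreeSum.isExample_semidirectProduct t⟩, fun M => ?_, ?_⟩
  · obtain ⟨T, hT⟩ := Filter.eventually_atTop.mp
      (CodegreeSum.tendsto_sum_one_div_prime23.eventually_ge_atTop (84 * M))
    refine ⟨T, fun t ht G _ hG => le_trans ?_ (CodegreeSum.sum_one_div_le_ratio hG)⟩
    linarith [hT t ht]
  -- This threshold forces a ratio of at least 2; any bound above 1 would give the strict
  -- inequality.
  · obtain ⟨t, ht⟩ := (CodegreeSum.tendsto_sum_one_div_prime23.eventually_ge_atTop (84 * 2)).exists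
    have hG := CodegreeSum.isExample_semidirectProduct t
    have hfin := CodegreeSum.finite_of_isExample hG
    refine ⟨_, _, inferInstance, hfin, rfl, ?_⟩
    have : NeZero (Nat.card (CodegreeSum.Kernel t ⋊[CodegreeSum.rotateHom t] CodegreeSum.C 3)) :=
      ⟨Nat.card_pos.ne'⟩
    rw [← one_lt_div (CodegreeSum.Sc_pos_of_comm _)]
    linarith [CodegreeSum.sum_one_div_le_ratio hG]
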